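/- A depth-$d$ 1D-QAC circuit acts on finitely many qubits arranged on a line and has the form $C = L_d M_d \cdots L_1 M_1 L_0$, where each $L_k$ is a layer of arbitrary single-qubit unitaries and each $M_k$ is a layer of generalized CZ gates with pairwise disjoint supports, every support being an interval of consecutive qubits. (The generalized CZ gate with support $T$ multiplies a computational basis state by $-1$ if all qubits of $T$ are $1$, and fixes it otherwise.) Such a circuit has input size $n$ if $n$ of its qubits, at arbitrary positions on the line, are designated as input qubits; the remaining qubits, of which there may be any finite number, are ancillas. On input $x \in \{0,1\}^n$ the input qubits are initialized to $|x\rangle$ and the ancillas to an arbitrary fixed joint state $|a\rangle$ independent of $x$; after $C$ is applied, one designated qubit is measured in the computational basis, and $g_C(x) \in \{0,1\}$ denotes the random outcome. Let $\mathrm{PARITY}_n(x) = x_1 \oplus \cdots \oplus x_n$. **Theorem.** Let $n, d \ge 1$ be integers, and let $C$ be a depth-$d$ 1D-QAC circuit with input size $n$. Then, for $x$ uniformly random in $\{0,1\}^n$, $$\Pr_{x, C}\left[g_C(x) = \mathrm{PARITY}_n(x)\right] \le \frac12 + 4\sqrt2\, d \cdot 2^{-n^{1/d}/6}.$$ In particular,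 every 1D-QAC circuit that computes $\mathrm{PARITY}_n$ with average-case success probability at least $2/3$ has depth $\Omega(\log n / \log\log n)$: there are constants $c > 0$ and $n_0$ such that, for all $n \ge n_0$, every 1D-QAC circuit $C$ with input size $n$ and $\Pr_{x,C}[g_C(x) = \mathrm{PARITY}_n(x)] \ge 2/3$ has depth at least $c \log n / \log\log n$. -/

import Mathlib

open scoped BigOperators Matrix

/-- Computational basis labels of `N` qubits on a line; `true` is the basis value `1`. -/
abbrev QBits (N : ℕ) : Type := Fin N → Bool

/-- A layer of single-qubit unitaries on a line of `N` qubits: one `2 × 2` unitary per qubit. -/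
abbrev SingleLayer (N : ℕ) : Type := Fin N → Matrix.unitaryGroup Bool ℂ

/-- The tensor product of the single-qubit unitaries of a layer, as a `2^N × 2^N` matrix. -/
noncomputable def SingleLayer.toMatrix {N : ℕ} (L : SingleLayer N) :
    Matrix (QBits N) (QBits N) ℂ :=
  Matrix.of fun b c => ∏ q : Fin N, (L q : Matrix Bool Bool ℂ) (b q) (c q)

/-- A layer of generalized CZ gates on a line of `N` qubits. A gate is given by its support, which
has to be a nonempty interval of consecutive qubits; the gates of a layer have pairwise disjoint
supports. A layer may have any number of gates, of any sizes. -/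
structure CZLayer (N : ℕ) where
  gates : Finset (Finset (Fin N))
  contiguous : ∀ T ∈ gates, ∃ a b : Fin N, a ≤ b ∧ T = Finset.Icc a b
  disjoint : (gates : Set (Finset (Fin N))).PairwiseDisjoint id

/-- The eigenvalue of the CZ gate with support `T` on the basis vector `b`: it is `-1` if all
qubits of `T` have the value `1`, and `1` otherwise. -/
def czPhase {N : ℕ} (T : Finset (Fin N)) (b : QBits N) : ℂ :=
  if ∀ q ∈ T, b q = true then -1 else 1

/-- The product of the (commuting, diagonal) CZ gates of a layer, as a `2^N × 2^N` matrix. -/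
noncomputable def CZLayer.toMatrix {N : ℕ} (M : CZLayer N) :
    Matrix (QBits N) (QBits N) ℂ :=
  Matrix.diagonal fun b => ∏ T ∈ M.gates, czPhase T b

/-- One-dimensional QAC circuits `L_d M_d ⋯ L_1 M_1 L_0` on a line of `N` qubits, indexed by the
depth `d`, which is the number of CZ layers. -/
inductive OneDQAC (N : ℕ) : ℕ → Type
  | base (L : SingleLayer N) : OneDQAC N 0
  | layer {d : ℕ} (C : OneDQAC N d) (M : CZLayer N) (L : SingleLayer N) : OneDQAC N (d + 1)

/-- The unitary implemented by a circuit. -/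
noncomputable def OneDQAC.toMatrix {N : ℕ} :
    {d : ℕ} → OneDQAC N d → Matrix (QBits N) (QBits N) ℂ
  | _, .base L => L.toMatrix
  | _, .layer C M L => L.toMatrix * M.toMatrix * C.toMatrix

/-- A depth-`d` one-dimensional QAC circuit on a line of `N` qubits that is used to compute a
Boolean function of `n` bits: `input i` is the position of the `i`-th input qubit (any distinct
positions), all the other qubits are ancillas, `ancilla` is their joint initial state (any unit
vector), and `output` is the position of the qubit that is measured. -/
structure OneDQACWithInput (n N d : ℕ) where
  circuit : OneDQAC N d
  input : Fin n ↪ Fin N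
  ancilla : EuclideanSpace ℂ ({q : Fin N // q ∉ Set.range input} → Bool)
  ancilla_norm : ‖ancilla‖ = 1
  output : Fin N

namespace OneDQACWithInput

variable {n N d : ℕ}

/-- The initial state `|x⟩ ⊗ |a⟩`, with `|x⟩` on the input qubits and `|a⟩` on the ancillas. -/
noncomputable def initialState (C : OneDQACWithInput n N d) (x : Fin n → Bool) : QBits N → ℂ :=
  fun b => if ∀ i, b (C.input i) = x i then C.ancilla (fun q => b q.1) else 0

/-- The final state of the circuit on the input `x`. -/
noncomputable def finalState (C : OneDQACWithInput n N d) (x : Fin n → Bool) : QBits N → ℂ :=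
  C.circuit.toMatrix *ᵥ C.initialState x

/-- The probability that measuring the output qubit of the final state on the input `x` in the
computational basis gives the outcome `v`. -/
noncomputable def outcomeProb (C : OneDQACWithInput n N d) (x : Fin n → Bool) (v : Bool) : ℝ :=
  ∑ b : QBits N, if b C.output = v then ‖C.finalState x b‖ ^ 2 else 0

/-- The probability, over a uniformly random `x ∈ {0,1}ⁿ` and the measurement, that the measured
outcome is `f x`. -/
noncomputable def successProb (C : OneDQACWithInput n N d) (f : (Fin n → Bool) → Bool) : ℝ :=
  (∑ x : Fin n → Bool, C.outcomeProb x (f x)) / 2 ^ n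

end OneDQACWithInput

/-- The parity function: `1` exactly when an odd number of the bits are `1`. -/
def parityFn (n : ℕ) (x : Fin n → Bool) : Bool :=
  decide (Odd (Finset.univ.filter fun i => x i = true).card)

/-!
A CZ gate acts nontrivially only on the basis vectors that are all-ones on its support. If the
support contains the forward light cones of at least `k` inputs, then, over a uniformly random
input, the all-ones part of the state has mean squared norm at most `2 ^ (-k)`. A layer has at most
`n / k` such heavy gates, and removing all of them costs at most `2 √(n / (k 2 ^ k))` in norm.

Once the heavy gates are gone, the number of light cones crossing a cut of the line at most doubles
in each layer, up to an additive `k - 1`: a cone that crosses the cut after a layer in which a gate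
on `[a, b]` straddles it was contained in `[a, b]` or crossed one of the ends of `[a, b]` before.
Hence at most `2 (k - 1) (2 ^ d - 1) + 1` cones reach the output qubit. If `n` is larger, flipping
an input whose cone misses the output changes the parity but not the outcome distribution, so the
pruned circuit succeeds with probability exactly `1 / 2`. The bound results from
`k = ⌊n / (2 (2 ^ d - 1))⌋`.
-/

section SiteMatrices

variable {ι κ R : Type*} [Fintype ι] [DecidableEq ι] [Fintype κ] [DecidableEq κ] [CommSemiring R]

/-- The tensor (Kronecker) product of a family of matrices, one for each site `q : ι`, acting on
the functions on the configurations `ι → κ`; it is bundled as a monoid homomorphism. -/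
def tensorMatrix : (ι → Matrix κ κ R) →* Matrix (ι → κ) (ι → κ) R where
  toFun m := Matrix.of fun b c => ∏ q, m q (b q) (c q)
  map_one' := by
    ext b c
    simp only [Matrix.of_apply, Pi.one_apply, Matrix.one_apply, Finset.prod_boole,
      Finset.mem_univ, true_imp_iff, funext_iff]
  map_mul' m m' := by
    ext b c
    simp only [Matrix.mul_apply, Matrix.of_apply, Pi.mul_apply, ← Finset.prod_mul_distrib]
    rw [Finset.prod_univ_sum, Fintype.piFinset_univ]

theorem tensorMatrix_apply (m : ι → Matrix κ κ R) (b c : ι → κ) :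
    tensorMatrix m b c = ∏ q, m q (b q) (c q) := rfl

theorem star_tensorMatrix [StarRing R] (m : ι → Matrix κ κ R) :
    star (tensorMatrix m) = tensorMatrix (star m) := by
  ext b c
  simp only [Matrix.star_apply, tensorMatrix_apply, star_prod, Pi.star_apply]

theorem tensorMatrix_mem_unitary [StarRing R] {m : ι → Matrix κ κ R}
    (hm : ∀ q, m q ∈ unitary (Matrix κ κ R)) :
    tensorMatrix m ∈ unitary (Matrix (ι → κ) (ι → κ) R) := by
  rw [Unitary.mem_iff, star_tensorMatrix, ← map_mul, ← map_mul]
  constructor <;> convert map_one tensorMatrix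
  · exact funext fun q => Unitary.star_mul_self_of_mem (hm q)
  · exact funext fun q => Unitary.mul_star_self_of_mem (hm q)

/-- The tensor product of a family of unitaries, as an element of the unitary group. -/
def tensorUnitary [StarRing R] (u : ι → unitary (Matrix κ κ R)) :
    unitary (Matrix (ι → κ) (ι → κ) R) :=
  ⟨tensorMatrix fun q => u q, tensorMatrix_mem_unitary fun q => (u q).2⟩

theorem coe_tensorUnitary [StarRing R] (u : ι → unitary (Matrix κ κ R)) :
    (tensorUnitary u : Matrix (ι → κ) (ι → κ) R) = tensorMatrix fun q => (u q : Matrix κ κ R) :=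
  rfl

/-- The matrix `m` acting on the single site `q`. -/
def siteMatrix (q : ι) (m : Matrix κ κ R) : Matrix (ι → κ) (ι → κ) R :=
  tensorMatrix (Pi.mulSingle q m)

theorem siteMatrix_apply_update (q : ι) (m : Matrix κ κ R) (b : ι → κ) (v : κ) :
    siteMatrix q m b (Function.update b q v) = m (b q) v := by
  rw [siteMatrix, tensorMatrix_apply, Fintype.prod_eq_single q]
  · simp only [Pi.mulSingle_eq_same, Function.update_self]
  · intro r hr
    rw [Pi.mulSingle_eq_of_ne hr, Function.update_of_ne hr, Matrix.one_apply_eq]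

theorem siteMatrix_apply_of_ne {q r : ι} (hr : r ≠ q) (m : Matrix κ κ R) {b c : ι → κ}
    (hbc : b r ≠ c r) : siteMatrix q m b c = 0 := by
  rw [siteMatrix, tensorMatrix_apply]
  refine Finset.prod_eq_zero (Finset.mem_univ r) ?_
  rw [Pi.mulSingle_eq_of_ne hr, Matrix.one_apply_ne hbc]

theorem siteMatrix_transpose (q : ι) (m : Matrix κ κ R) :
    (siteMatrix q m)ᵀ = siteMatrix q mᵀ := by
  ext b c
  simp only [siteMatrix, Matrix.transpose_apply, tensorMatrix_apply]
  refine Finset.prod_congr rfl fun r _ => ?_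
  rcases eq_or_ne r q with rfl | hr
  · simp only [Pi.mulSingle_eq_same, Matrix.transpose_apply]
  · simp only [Pi.mulSingle_eq_of_ne hr, Matrix.one_apply, eq_comm]

theorem siteMatrix_mulVec (q : ι) (m : Matrix κ κ R) (ψ : (ι → κ) → R) (b : ι → κ) :
    (siteMatrix q m *ᵥ ψ) b = ∑ v, m (b q) v * ψ (Function.update b q v) := by
  simp only [← siteMatrix_apply_update q m b]
  refine (Fintype.sum_of_injective _ (Function.update_injective b q) _
    (fun c => siteMatrix q m b c * ψ c) (fun c hc => ?_) fun _ => rfl).symm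
  obtain ⟨r, hr, hbc⟩ : ∃ r ≠ q, b r ≠ c r := by
    by_contra! h
    exact hc ⟨c q, Function.update_eq_iff.mpr ⟨rfl, h⟩⟩
  rw [siteMatrix_apply_of_ne hr m hbc, zero_mul]

theorem siteMatrix_mul_apply (q : ι) (m : Matrix κ κ R) (A : Matrix (ι → κ) (ι → κ) R)
    (b c : ι → κ) :
    (siteMatrix q m * A) b c = ∑ v, m (b q) v * A (Function.update b q v) c :=
  siteMatrix_mulVec q m (A.col c) b

theorem mul_siteMatrix_apply (q : ι) (m : Matrix κ κ R) (A : Matrix (ι → κ) (ι → κ) R)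
    (b c : ι → κ) :
    (A * siteMatrix q m) b c = ∑ v, A b (Function.update c q v) * m v (c q) := by
  rw [← Matrix.transpose_apply (A * _), Matrix.transpose_mul, siteMatrix_transpose,
    siteMatrix_mul_apply]
  simp only [Matrix.transpose_apply, mul_comm]

theorem siteMatrix_mem_unitary [StarRing R] (q : ι) {m : Matrix κ κ R}
    (hm : m ∈ unitary (Matrix κ κ R)) :
    siteMatrix q m ∈ unitary (Matrix (ι → κ) (ι → κ) R) := by
  refine tensorMatrix_mem_unitary fun r => ?_
  rcases eq_or_ne r q with rfl | hr
  · rwa [Pi.mulSingle_eq_same]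
  · rw [Pi.mulSingle_eq_of_ne hr]
    exact one_mem _

/-- The matrix `A` acts as the identity outside the set `S` of sites, expressed as: it commutes with
every matrix acting on a single site outside `S`. -/
def ActsOn (S : Finset ι) (A : Matrix (ι → κ) (ι → κ) R) : Prop :=
  ∀ q ∉ S, ∀ m, Commute (siteMatrix q m) A

theorem actsOn_siteMatrix (q : ι) (m : Matrix κ κ R) : ActsOn {q} (siteMatrix q m) :=
  fun r hr m' => by
    have hcomm := Pi.mulSingle_commute (f := fun _ : ι => Matrix κ κ R)
      (Finset.notMem_singleton.mp hr) m' m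
    exact hcomm.map tensorMatrix

theorem actsOn_diagonal {S : Finset ι} {f : (ι → κ) → R}
    (hf : ∀ b c, (∀ q ∈ S, b q = c q) → f b = f c) : ActsOn S (Matrix.diagonal f) := by
  intro q hq m
  ext b c
  rw [Matrix.diagonal_mul, Matrix.mul_diagonal]
  by_cases h : ∀ r ≠ q, b r = c r
  · rw [hf b c fun r hr => h r (ne_of_mem_of_not_mem hr hq), mul_comm]
  · push Not at h
    obtain ⟨r, hr, hbc⟩ := h
    rw [siteMatrix_apply_of_ne hr m hbc, zero_mul, mul_zero]

namespace ActsOn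

variable {S T : Finset ι} {A B : Matrix (ι → κ) (ι → κ) R}

theorem mono (hA : ActsOn S A) (hST : S ⊆ T) : ActsOn T A :=
  fun q hq => hA q fun hqS => hq (hST hqS)

theorem mul (hA : ActsOn S A) (hB : ActsOn S B) : ActsOn S (A * B) :=
  fun q hq m => (hA q hq m).mul_right (hB q hq m)

theorem apply_eq_zero (hA : ActsOn S A) {q : ι} (hq : q ∉ S) {b c : ι → κ} (hbc : b q ≠ c q) :
    A b c = 0 := by
  have h := congrFun₂ (hA q hq (Matrix.single (b q) (b q) 1)).eq b c
  simpa [siteMatrix_mul_apply, mul_siteMatrix_apply, Matrix.single_apply, hbc] using h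

theorem apply_update_update (hA : ActsOn S A) {q : ι} (hq : q ∉ S) (b : ι → κ) (v : κ) :
    A (Function.update b q v) (Function.update b q v) = A b b := by
  have h := congrFun₂ (hA q hq (Matrix.single (b q) v 1)).eq b (Function.update b q v)
  simpa [siteMatrix_mul_apply, mul_siteMatrix_apply, Matrix.single_apply] using h

theorem apply_self_congr (hA : ActsOn S A) {b c : ι → κ} (hbc : ∀ q ∈ S, b q = c q) :
    A b b = A c c := by
  suffices h : ∀ F : Finset ι, Disjoint F S → A (F.piecewise c b) (F.piecewise c b) = A b b by
    rw [← h Sᶜ disjoint_compl_left]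
    congr 1 <;> ext q <;> by_cases hq : q ∈ S <;> simp [hq, hbc]
  intro F
  induction F using Finset.induction_on with
  | empty => simp only [Finset.piecewise_empty, implies_true]
  | insert q F _ ih =>
    intro hF
    rw [Finset.disjoint_insert_left] at hF
    rw [Finset.piecewise_insert, hA.apply_update_update hF.1, ih hF.2]

theorem commute_diagonal (hA : ActsOn S A) {f : (ι → κ) → R}
    (hf : ∀ b c, (∀ q ∉ S, b q = c q) → f b = f c) : Commute (Matrix.diagonal f) A := by
  ext b c
  rw [Matrix.diagonal_mul, Matrix.mul_diagonal]
  by_cases hbc : ∀ q ∉ S, b q = c q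
  · rw [hf b c hbc, mul_comm]
  · push Not at hbc
    obtain ⟨q, hq, hne⟩ := hbc
    rw [hA.apply_eq_zero hq hne, mul_zero, zero_mul]

end ActsOn

/-- The projection onto the span of the basis vectors `|b⟩` with `b` in the cylinder set
`{b | b q = e q for all q ∈ T}`. -/
def cylinderProj (T : Finset ι) (e : ι → κ) : Matrix (ι → κ) (ι → κ) R :=
  Matrix.diagonal fun b => if ∀ q ∈ T, b q = e q then 1 else 0

theorem cylinderProj_mulVec (T : Finset ι) (e : ι → κ) (ψ : (ι → κ) → R) (b : ι → κ) :
    (cylinderProj T e *ᵥ ψ) b = if ∀ q ∈ T, b q = e q then ψ b else 0 := by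
  rw [cylinderProj, Matrix.mulVec_diagonal, ite_mul, one_mul, zero_mul]

theorem isStarProjection_cylinderProj [StarRing R] (T : Finset ι) (e : ι → κ) :
    IsStarProjection (cylinderProj T e : Matrix (ι → κ) (ι → κ) R) where
  isIdempotentElem := by
    rw [IsIdempotentElem, cylinderProj, Matrix.diagonal_mul_diagonal]
    simp only [mul_ite, mul_one, mul_zero]
    congr! 2
    split_ifs <;> rfl
  isSelfAdjoint := by
    rw [IsSelfAdjoint, cylinderProj, Matrix.star_eq_conjTranspose, Matrix.diagonal_conjTranspose]
    congr! 2 with b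
    rw [Pi.star_apply, apply_ite star, star_one, star_zero]

theorem actsOn_cylinderProj (T : Finset ι) (e : ι → κ) :
    ActsOn T (cylinderProj T e : Matrix (ι → κ) (ι → κ) R) :=
  actsOn_diagonal fun b c hbc => by
    congr 1
    exact propext (forall₂_congr fun q hq => by rw [hbc q hq])

theorem ActsOn.commute_cylinderProj {S T : Finset ι} {A : Matrix (ι → κ) (ι → κ) R}
    (hA : ActsOn S A) (hST : Disjoint S T) (e : ι → κ) : Commute (cylinderProj T e) A :=
  hA.commute_diagonal fun b c hbc => by
    congr 1
    exact propext (forall₂_congr fun q hq => by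
      rw [hbc q (Finset.disjoint_right.mp hST hq)])

theorem ActsOn.cylinderProj_mul_mul_cylinderProj {T : Finset ι} {A : Matrix (ι → κ) (ι → κ) R}
    (hA : ActsOn T A) (e : ι → κ) :
    cylinderProj T e * A * cylinderProj T e = A e e • cylinderProj T e := by
  ext b c
  rw [cylinderProj, Matrix.mul_diagonal, Matrix.diagonal_mul, Matrix.smul_apply, smul_eq_mul,
    Matrix.diagonal_apply]
  by_cases hb : ∀ q ∈ T, b q = e q
  · by_cases hc : ∀ q ∈ T, c q = e q
    · rw [if_pos hb, if_pos hc, one_mul, mul_one]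
      rcases eq_or_ne b c with rfl | hbc
      · rw [if_pos rfl, mul_one, hA.apply_self_congr hb]
      · obtain ⟨q, hq⟩ := Function.ne_iff.mp hbc
        rw [if_neg hbc, mul_zero,
          hA.apply_eq_zero (fun hqT => hq ((hb q hqT).trans (hc q hqT).symm)) hq]
    · have hbc : b ≠ c := by
        rintro rfl
        exact hc hb
      rw [if_neg hc, if_neg hbc, mul_zero, mul_zero]
  · rw [if_neg hb, ite_self, zero_mul, zero_mul, mul_zero]

theorem card_filter_forall_mem_eq {α : Type*} [Fintype α] [DecidableEq α] (S : Finset α)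
    (y : α → κ) :
    (Finset.univ.filter fun x : α → κ => ∀ i ∈ S, y i = x i).card
      = Fintype.card κ ^ (Fintype.card α - S.card) := by
  have h : (Finset.univ.filter fun x : α → κ => ∀ i ∈ S, y i = x i)
      = Fintype.piFinset fun i => if i ∈ S then {y i} else Finset.univ := by
    ext x
    simp only [Finset.mem_filter, Finset.mem_univ, true_and, Fintype.mem_piFinset]
    refine forall_congr' fun i => ?_
    by_cases hi : i ∈ S <;> simp [hi, eq_comm (a := y i)]
  rw [h, Fintype.card_piFinset]
  simp only [apply_ite Finset.card, Finset.card_singleton, Finset.card_univ, Finset.prod_ite,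
    Finset.prod_const_one, one_mul, Finset.prod_const]
  rw [Finset.filter_not, Finset.filter_mem_eq_inter, Finset.univ_inter,
    ← Finset.compl_eq_univ_sdiff, Finset.card_compl]

theorem sum_cylinderProj_extend {α : Type*} [Fintype α] [DecidableEq α] (input : α ↪ ι)
    (S : Finset α) (e : ι → κ) :
    ∑ x : α → κ, cylinderProj (S.map input) (Function.extend input x e)
      = ((Fintype.card κ : R) ^ (Fintype.card α - S.card)) •
        (1 : Matrix (ι → κ) (ι → κ) R) := by
  have hsum (b : ι → κ) :
      (∑ x : α → κ, if ∀ q ∈ S.map input, b q = Function.extend input x e q then (1 : R) else 0)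
        = (Fintype.card κ : R) ^ (Fintype.card α - S.card) := by
    simp only [Finset.forall_mem_map, input.injective.extend_apply, Finset.sum_boole]
    rw [card_filter_forall_mem_eq S fun i => b (input i), Nat.cast_pow]
  ext b c
  simp only [Matrix.sum_apply, cylinderProj, Matrix.smul_apply, Matrix.diagonal_apply,
    Matrix.one_apply, smul_eq_mul]
  split_ifs
  · rw [hsum, mul_one]
  · rw [Finset.sum_const_zero, mul_zero]

end SiteMatrices

section LightCones

theorem conjStarAlgAut_tensorUnitary_siteMatrix {ι κ R : Type*} [Fintype ι] [DecidableEq ι]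
    [Fintype κ] [DecidableEq κ] [CommSemiring R] [StarRing R] (u : ι → unitary (Matrix κ κ R))
    (q : ι) (m : Matrix κ κ R) :
    Unitary.conjStarAlgAut R _ (tensorUnitary u) (siteMatrix q m)
      = siteMatrix q (Unitary.conjStarAlgAut R _ (u q) m) := by
  rw [Unitary.conjStarAlgAut_apply, Unitary.conjStarAlgAut_apply, siteMatrix, siteMatrix,
    coe_tensorUnitary, star_tensorMatrix, ← map_mul, ← map_mul]
  congr 1
  funext r
  rcases eq_or_ne r q with rfl | hr
  · simp only [Pi.mul_apply, Pi.mulSingle_eq_same, Pi.star_apply]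
  · simp only [Pi.mul_apply, Pi.mulSingle_eq_of_ne hr, mul_one, Pi.star_apply,
      Unitary.mul_star_self_of_mem (u r).2]

theorem ActsOn.conj_tensorUnitary {ι κ R : Type*} [Fintype ι] [DecidableEq ι]
    [Fintype κ] [DecidableEq κ] [CommSemiring R] [StarRing R] {S : Finset ι}
    {A : Matrix (ι → κ) (ι → κ) R} (hA : ActsOn S A) (u : ι → unitary (Matrix κ κ R)) :
    ActsOn S (Unitary.conjStarAlgAut R _ (tensorUnitary u) A) := by
  intro q hq m
  rw [← (Unitary.conjStarAlgAut R _ (u q)).apply_symm_apply m,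
    ← conjStarAlgAut_tensorUnitary_siteMatrix]
  exact (hA q hq _).map _

variable {N d : ℕ}

theorem star_czPhase (T : Finset (Fin N)) (b : QBits N) : star (czPhase T b) = czPhase T b := by
  rw [czPhase, apply_ite star, star_neg, star_one]

theorem czPhase_mul_self (T : Finset (Fin N)) (b : QBits N) : czPhase T b * czPhase T b = 1 := by
  rw [czPhase]
  split_ifs
  · rw [neg_mul_neg, one_mul]
  · rw [one_mul]

theorem czPhase_congr {T : Finset (Fin N)} {b c : QBits N} (h : ∀ q ∈ T, b q = c q) :
    czPhase T b = czPhase T c := by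
  rw [czPhase, czPhase]
  congr 1
  exact propext (forall₂_congr fun q hq => by rw [h q hq])

namespace CZLayer

theorem star_toMatrix (M : CZLayer N) : star M.toMatrix = M.toMatrix := by
  rw [toMatrix, Matrix.star_eq_conjTranspose, Matrix.diagonal_conjTranspose]
  congr 1
  funext b
  rw [Pi.star_apply, star_prod]
  exact Finset.prod_congr rfl fun T _ => star_czPhase T b

theorem toMatrix_mul_self (M : CZLayer N) : M.toMatrix * M.toMatrix = 1 := by
  rw [toMatrix, Matrix.diagonal_mul_diagonal, ← Matrix.diagonal_one]
  congr 1
  funext b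
  rw [← Finset.prod_mul_distrib]
  exact Finset.prod_eq_one fun T _ => czPhase_mul_self T b

/-- The product of the CZ gates of a layer, as an element of the unitary group. -/
noncomputable def unitary (M : CZLayer N) : Matrix.unitaryGroup (QBits N) ℂ :=
  ⟨M.toMatrix, by rw [Unitary.mem_iff, star_toMatrix, toMatrix_mul_self, and_self]⟩

/-- The layer consisting of those gates of `M` whose support satisfies `p`. -/
def restrict (M : CZLayer N) (p : Finset (Fin N) → Prop) [DecidablePred p] : CZLayer N where
  gates := M.gates.filter p
  contiguous T hT := M.contiguous T (Finset.mem_of_mem_filter T hT)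
  disjoint := M.disjoint.subset (Finset.coe_subset.mpr (Finset.filter_subset _ _))

theorem unitary_restrict_not_mul_restrict (M : CZLayer N) (p : Finset (Fin N) → Prop)
    [DecidablePred p] :
    (M.restrict fun T => ¬ p T).unitary * (M.restrict p).unitary = M.unitary := by
  refine Subtype.ext ?_
  change (M.restrict fun T => ¬ p T).toMatrix * (M.restrict p).toMatrix = M.toMatrix
  rw [toMatrix, toMatrix, Matrix.diagonal_mul_diagonal]
  exact congrArg _ (funext fun b => Finset.prod_filter_not_mul_prod_filter _ _ _)

/-- The qubits of `S` together with those of all the gates of `M` that meet `S`. -/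
def spread (M : CZLayer N) (S : Finset (Fin N)) : Finset (Fin N) :=
  S ∪ (M.gates.filter fun T => ¬ Disjoint T S).biUnion id

theorem mem_spread {M : CZLayer N} {S : Finset (Fin N)} {q : Fin N} :
    q ∈ M.spread S ↔ q ∈ S ∨ ∃ T ∈ M.gates, q ∈ T ∧ ∃ r ∈ T, r ∈ S := by
  simp only [spread, Finset.mem_union, Finset.mem_biUnion, Finset.mem_filter, id_eq,
    Finset.not_disjoint_iff, and_assoc, and_comm (a := ∃ r ∈ _, r ∈ S)]

end CZLayer

theorem ActsOn.conj_czLayer {S : Finset (Fin N)} {A : Matrix (QBits N) (QBits N) ℂ}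
    (hA : ActsOn S A) (M : CZLayer N) :
    ActsOn (M.spread S) (Unitary.conjStarAlgAut ℂ _ M.unitary A) := by
  set near := M.restrict fun T => ¬ Disjoint T S
  set far := M.restrict fun T => Disjoint T S
  have hfar : Commute (far.unitary : Matrix (QBits N) (QBits N) ℂ) A :=
    hA.commute_diagonal fun b c hbc => Finset.prod_congr rfl fun T hT => czPhase_congr fun q hq =>
      hbc q (Finset.disjoint_left.mp (Finset.mem_filter.mp hT).2 hq)
  have hnear : ActsOn (M.spread S) near.toMatrix :=
    actsOn_diagonal fun b c hbc => Finset.prod_congr rfl fun T hT => czPhase_congr fun q hq =>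
      hbc q (Finset.mem_union_right _ (Finset.mem_biUnion.mpr ⟨T, hT, hq⟩))
  have hconj : Unitary.conjStarAlgAut ℂ _ far.unitary A = A := by
    rw [Unitary.conjStarAlgAut_apply, hfar.eq, mul_assoc,
      Unitary.mul_star_self_of_mem far.unitary.2, mul_one]
  rw [← M.unitary_restrict_not_mul_restrict fun T => Disjoint T S,
    Unitary.conjStarAlgAut_mul_apply, hconj]
  change ActsOn _ (near.toMatrix * A * star near.toMatrix)
  rw [near.star_toMatrix]
  exact (hnear.mul (hA.mono Finset.subset_union_left)).mul hnear

namespace OneDQAC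

/-- The unitary implemented by a circuit, as an element of the unitary group. -/
noncomputable def unitary : {d : ℕ} → OneDQAC N d → Matrix.unitaryGroup (QBits N) ℂ
  | _, .base L => tensorUnitary L
  | _, .layer C M L => tensorUnitary L * M.unitary * C.unitary

theorem coe_unitary (C : OneDQAC N d) :
    (C.unitary : Matrix (QBits N) (QBits N) ℂ) = C.toMatrix := by
  induction C with
  | base L => rfl
  | layer C M L ih => exact congrArg (L.toMatrix * M.toMatrix * ·) ih

/-- The forward light cone of the set `S` of qubits: the qubits at the end of the circuit that are
connected to `S` through the supports of gates. -/
def cone : {d : ℕ} → OneDQAC N d → Finset (Fin N) → Finset (Fin N)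
  | _, .base _, S => S
  | _, .layer C M _, S => M.spread (C.cone S)

theorem subset_cone (C : OneDQAC N d) (S : Finset (Fin N)) : S ⊆ C.cone S := by
  induction C with
  | base => exact subset_rfl
  | layer C M L ih => exact ih.trans Finset.subset_union_left

theorem mem_cone_iff {C : OneDQAC N d} {S : Finset (Fin N)} {q : Fin N} :
    q ∈ C.cone S ↔ ∃ r ∈ S, q ∈ C.cone {r} := by
  induction C generalizing q with
  | base L => simp only [cone, Finset.mem_singleton, exists_eq_right']
  | layer C M L ih =>
    simp only [cone, CZLayer.mem_spread, ih (q := _)]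
    grind

end OneDQAC

theorem ActsOn.conj_circuit {S : Finset (Fin N)} {A : Matrix (QBits N) (QBits N) ℂ}
    (hA : ActsOn S A) (C : OneDQAC N d) :
    ActsOn (C.cone S) (Unitary.conjStarAlgAut ℂ _ C.unitary A) := by
  induction C with
  | base L => exact hA.conj_tensorUnitary L
  | layer C M L ih =>
    rw [OneDQAC.unitary, Unitary.conjStarAlgAut_mul_apply, Unitary.conjStarAlgAut_mul_apply]
    exact (ih.conj_czLayer M).conj_tensorUnitary L

end LightCones

section Norms

variable {𝕜 ι κ α : Type*} [RCLike 𝕜] [Fintype ι] [Fintype κ] [Fintype α]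

theorem norm_apply_self_of_isStarProjection {P : Matrix ι ι 𝕜} (hP : IsStarProjection P) (i : ι) :
    ‖P i i‖ = RCLike.re (P i i) := by
  have h : P i i = ((∑ j, ‖P i j‖ ^ 2 : ℝ) : 𝕜) := by
    calc P i i = (P * star P) i i := by rw [hP.isSelfAdjoint.star_eq, hP.isIdempotentElem.eq]
      _ = ((∑ j, ‖P i j‖ ^ 2 : ℝ) : 𝕜) := by
        simp only [Matrix.mul_apply, Matrix.star_apply, RCLike.star_def, RCLike.mul_conj,
          RCLike.ofReal_sum, RCLike.ofReal_pow]
  rw [h, RCLike.ofReal_re, RCLike.norm_ofReal, abs_of_nonneg (by positivity)]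

variable [DecidableEq ι] [DecidableEq κ]

theorem norm_toLp_unitary_mulVec (U : Matrix.unitaryGroup ι 𝕜) (ψ : ι → 𝕜) :
    ‖WithLp.toLp 2 ((U : Matrix ι ι 𝕜) *ᵥ ψ)‖ = ‖WithLp.toLp 2 ψ‖ :=
  Unitary.norm_map ⟨Matrix.toEuclideanCLM (n := ι) (𝕜 := 𝕜) U,
    Unitary.map_mem (Matrix.toEuclideanCLM (n := ι) (𝕜 := 𝕜)) U.2⟩ (WithLp.toLp 2 ψ)

section

open scoped Matrix.Norms.L2Operator

/- With `E` the cylinder projection, the C⋆-identity gives `‖E P‖² = ‖E P E‖ = ‖P e e • E‖`. -/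
theorem norm_toLp_cylinderProj_mulVec_sq_le {T : Finset ι} {P : Matrix (ι → κ) (ι → κ) 𝕜}
    (hP : IsStarProjection P) (hPT : ActsOn T P) (e : ι → κ) {ψ : (ι → κ) → 𝕜}
    (hψ : P *ᵥ ψ = ψ) :
    ‖WithLp.toLp 2 (cylinderProj T e *ᵥ ψ)‖ ^ 2 ≤ RCLike.re (P e e) * ‖WithLp.toLp 2 ψ‖ ^ 2 := by
  set E : Matrix (ι → κ) (ι → κ) 𝕜 := cylinderProj T e
  have hE : IsStarProjection E := isStarProjection_cylinderProj T e
  have hEP : ‖E * P‖ ^ 2 ≤ RCLike.re (P e e) :=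
    calc ‖E * P‖ ^ 2 = ‖E * P * star (E * P)‖ := by rw [sq, CStarRing.norm_self_mul_star]
      _ = ‖E * P * E‖ := by
        rw [star_mul, hP.isSelfAdjoint.star_eq, hE.isSelfAdjoint.star_eq, mul_assoc, mul_assoc,
          ← mul_assoc P P, hP.isIdempotentElem.eq]
      _ = ‖P e e‖ * ‖E‖ := by rw [hPT.cylinderProj_mul_mul_cylinderProj, norm_smul]
      _ ≤ ‖P e e‖ * 1 := by gcongr; exact hE.norm_le
      _ = RCLike.re (P e e) := by rw [mul_one, norm_apply_self_of_isStarProjection hP]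
  calc ‖WithLp.toLp 2 (E *ᵥ ψ)‖ ^ 2 = ‖WithLp.toLp 2 ((E * P) *ᵥ ψ)‖ ^ 2 := by
        rw [← Matrix.mulVec_mulVec, hψ]
    _ ≤ (‖E * P‖ * ‖WithLp.toLp 2 ψ‖) ^ 2 := by
        gcongr
        exact Matrix.l2_opNorm_mulVec (E * P) (WithLp.toLp 2 ψ)
    _ ≤ RCLike.re (P e e) * ‖WithLp.toLp 2 ψ‖ ^ 2 := by rw [mul_pow]; gcongr

end

open scoped Matrix.Norms.Frobenius

theorem frobenius_norm_sq_eq_sum_col {β : Type*} [Fintype β] (A : Matrix β α 𝕜) :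
    ‖A‖ ^ 2 = ∑ x, ‖WithLp.toLp 2 (A.col x)‖ ^ 2 := by
  rw [Matrix.frobenius_norm_def, ← Real.sqrt_eq_rpow, Real.sq_sqrt (by positivity),
    Finset.sum_comm]
  simp only [Real.rpow_two, EuclideanSpace.norm_sq_eq, Matrix.col_apply]

theorem frobenius_norm_unitary_mul (U : Matrix.unitaryGroup ι 𝕜) (A : Matrix ι α 𝕜) :
    ‖(U : Matrix ι ι 𝕜) * A‖ = ‖A‖ := by
  rw [← sq_eq_sq₀ (norm_nonneg _) (norm_nonneg _), frobenius_norm_sq_eq_sum_col,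
    frobenius_norm_sq_eq_sum_col]
  exact Finset.sum_congr rfl fun x _ => congrArg (· ^ 2) (norm_toLp_unitary_mulVec U (A.col x))

end Norms

namespace OneDQACWithInput

open scoped Matrix.Norms.Frobenius

variable {n N d k : ℕ}

theorem norm_toLp_initialState (I : OneDQACWithInput n N d) (x : Fin n → Bool) :
    ‖WithLp.toLp 2 (I.initialState x)‖ = 1 := by
  set merge : ({q // q ∉ Set.range I.input} → Bool) → QBits N := fun a =>
    Function.extend Subtype.val a (Function.extend I.input x fun _ => false)
  have hmerge_input (a) (i : Fin n) : merge a (I.input i) = x i := by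
    rw [← I.input.injective.extend_apply x (fun _ => false) i]
    exact Function.extend_apply' _ _ _ fun ⟨q, hq⟩ => q.2 ⟨i, hq.symm⟩
  have hmerge_ancilla (a) (q : {q // q ∉ Set.range I.input}) : merge a q = a q :=
    Subtype.val_injective.extend_apply a _ q
  rw [← I.ancilla_norm, ← sq_eq_sq₀ (norm_nonneg _) (norm_nonneg _), EuclideanSpace.norm_sq_eq,
    EuclideanSpace.norm_sq_eq]
  refine (Fintype.sum_of_injective merge (Function.extend_injective Subtype.val_injective _)
    (‖I.ancilla ·‖ ^ 2) (‖I.initialState x ·‖ ^ 2) (fun b hb => ?_) fun a => ?_).symm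
  · have hbx : ¬ ∀ i, b (I.input i) = x i := fun h => hb ⟨fun q => b q, funext fun q => by
      by_cases hq : q ∈ Set.range I.input
      · obtain ⟨i, rfl⟩ := hq
        rw [hmerge_input, h]
      · exact hmerge_ancilla _ ⟨q, hq⟩⟩
    rw [initialState, if_neg hbx, norm_zero, zero_pow two_ne_zero]
  · rw [initialState, if_pos (hmerge_input a)]
    simp only [hmerge_ancilla]

/-- The matrix whose columns are the initial states, one for each input. -/
noncomputable def initialMatrix (I : OneDQACWithInput n N d) :
    Matrix (QBits N) (Fin n → Bool) ℂ :=
  Matrix.of fun b x => I.initialState x b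

theorem norm_initialMatrix_sq (I : OneDQACWithInput n N d) : ‖I.initialMatrix‖ ^ 2 = 2 ^ n := by
  rw [frobenius_norm_sq_eq_sum_col]
  calc ∑ x, ‖WithLp.toLp 2 (I.initialMatrix.col x)‖ ^ 2
      = ∑ _x : Fin n → Bool, (1 : ℝ) := Finset.sum_congr rfl fun x _ => by
        change ‖WithLp.toLp 2 (I.initialState x)‖ ^ 2 = 1
        rw [I.norm_toLp_initialState, one_pow]
    _ = 2 ^ n := by simp

theorem cylinderProj_mulVec_initialState (I : OneDQACWithInput n N d) (S : Finset (Fin n))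
    (x : Fin n → Bool) (e : QBits N) :
    cylinderProj (S.map I.input) (Function.extend I.input x e) *ᵥ I.initialState x
      = I.initialState x := by
  funext b
  rw [cylinderProj_mulVec]
  simp only [Finset.forall_mem_map, I.input.injective.extend_apply]
  by_cases hb : ∀ i, b (I.input i) = x i
  · rw [if_pos fun i _ => hb i]
  · rw [initialState, if_neg hb, ite_self]

/- The state after `C` is fixed by the image under conjugation by `C` of the projection onto the
values of the inputs in `S`, which acts on `T`; averaging that projection over `x` gives the
identity divided by `2 ^ #S`. -/
theorem norm_cylinderProj_mul_initialMatrix_sq_le (I : OneDQACWithInput n N d) (C : OneDQAC N k)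
    {S : Finset (Fin n)} {T : Finset (Fin N)} (hST : C.cone (S.map I.input) ⊆ T) (e : QBits N) :
    ‖cylinderProj (R := ℂ) T e * (C.toMatrix * I.initialMatrix)‖ ^ 2 ≤ 2 ^ (n - S.card) := by
  set P : (Fin n → Bool) → Matrix (QBits N) (QBits N) ℂ := fun x =>
    cylinderProj (S.map I.input) (Function.extend I.input x e)
  set φ := Unitary.conjStarAlgAut ℂ (Matrix (QBits N) (QBits N) ℂ) C.unitary
  have hfix (x) : φ (P x) *ᵥ (C.toMatrix *ᵥ I.initialState x) = C.toMatrix *ᵥ I.initialState x := by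
    rw [Unitary.conjStarAlgAut_apply, C.coe_unitary.symm, Matrix.mulVec_mulVec, mul_assoc,
      Unitary.star_mul_self_of_mem C.unitary.2, mul_one, ← Matrix.mulVec_mulVec,
      I.cylinderProj_mulVec_initialState]
  have hsum : ∑ x, φ (P x) = (2 : ℂ) ^ (n - S.card) • 1 := by
    rw [← map_sum, sum_cylinderProj_extend, map_smul, map_one, Fintype.card_bool, Fintype.card_fin,
      Nat.cast_ofNat]
  rw [frobenius_norm_sq_eq_sum_col]
  calc ∑ x, ‖WithLp.toLp 2 ((cylinderProj (R := ℂ) T e * (C.toMatrix * I.initialMatrix)).col x)‖ ^ 2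
      ≤ ∑ x, (φ (P x) e e).re := Finset.sum_le_sum fun x _ => by
        refine (norm_toLp_cylinderProj_mulVec_sq_le
          ((isStarProjection_cylinderProj _ _).map φ)
          (((actsOn_cylinderProj _ _).conj_circuit C).mono hST) e (hfix x)).trans_eq ?_
        rw [← C.coe_unitary, norm_toLp_unitary_mulVec, I.norm_toLp_initialState, one_pow, mul_one]
        rfl
    _ = ((∑ x, φ (P x)) e e).re := by rw [Matrix.sum_apply, Complex.re_sum]
    _ = 2 ^ (n - S.card) := by
        rw [hsum, Matrix.smul_apply, Matrix.one_apply_eq, smul_eq_mul, mul_one]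
        norm_cast

end OneDQACWithInput

section Pruning

open scoped Matrix.Norms.Frobenius

variable {n N d k : ℕ}

theorem frobenius_norm_diagonal_mul_sq {𝕜 ι α : Type*} [RCLike 𝕜] [Fintype ι] [DecidableEq ι]
    [Fintype α] (f : ι → 𝕜) (Y : Matrix ι α 𝕜) :
    ‖Matrix.diagonal f * Y‖ ^ 2 = ∑ b, ‖f b‖ ^ 2 * ∑ x, ‖Y b x‖ ^ 2 := by
  rw [Matrix.frobenius_norm_def, ← Real.sqrt_eq_rpow, Real.sq_sqrt (by positivity)]
  simp only [Real.rpow_two, Matrix.diagonal_mul, norm_mul, mul_pow, Finset.mul_sum]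

theorem norm_czPhase (T : Finset (Fin N)) (b : QBits N) : ‖czPhase T b‖ = 1 := by
  rw [czPhase]
  split_ifs <;> simp only [norm_neg, norm_one]

theorem norm_prod_czPhase_sub_one_sq_le (G : Finset (Finset (Fin N))) (b : QBits N) :
    ‖∏ T ∈ G, czPhase T b - 1‖ ^ 2
      ≤ 4 * ∑ T ∈ G, ‖cylinderProj (R := ℂ) T (fun _ => true) b b‖ ^ 2 := by
  by_cases h : ∃ T ∈ G, ∀ q ∈ T, b q = true
  · obtain ⟨T, hT, hb⟩ := h
    have hproj : cylinderProj (R := ℂ) T (fun _ => true) b b = 1 := by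
      rw [cylinderProj, Matrix.diagonal_apply_eq, if_pos hb]
    calc ‖∏ T ∈ G, czPhase T b - 1‖ ^ 2 ≤ (‖∏ T ∈ G, czPhase T b‖ + ‖(1 : ℂ)‖) ^ 2 := by
          gcongr
          exact norm_sub_le _ _
      _ = 4 * ‖cylinderProj (R := ℂ) T (fun _ => true) b b‖ ^ 2 := by
          rw [norm_prod, Finset.prod_eq_one fun T _ => norm_czPhase T b, hproj, norm_one]
          norm_num
      _ ≤ 4 * ∑ T ∈ G, ‖cylinderProj (R := ℂ) T (fun _ => true) b b‖ ^ 2 := by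
          gcongr
          exact Finset.single_le_sum
            (f := fun T => ‖cylinderProj (R := ℂ) T (fun _ => true) b b‖ ^ 2)
            (fun _ _ => sq_nonneg _) hT
  · have hphase (T) (hT : T ∈ G) : czPhase T b = 1 := if_neg fun hb => h ⟨T, hT, hb⟩
    rw [Finset.prod_eq_one hphase, sub_self, norm_zero, zero_pow two_ne_zero]
    positivity

theorem CZLayer.norm_toMatrix_sub_one_mul_sq_le {α : Type*} [Fintype α] (M : CZLayer N)
    (Y : Matrix (QBits N) α ℂ) :
    ‖(M.toMatrix - 1) * Y‖ ^ 2
      ≤ 4 * ∑ T ∈ M.gates, ‖cylinderProj (R := ℂ) T (fun _ => true) * Y‖ ^ 2 := by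
  rw [toMatrix, ← Matrix.diagonal_one, Matrix.diagonal_sub, frobenius_norm_diagonal_mul_sq]
  simp only [cylinderProj, frobenius_norm_diagonal_mul_sq]
  rw [Finset.sum_comm, Finset.mul_sum]
  refine Finset.sum_le_sum fun b _ => ?_
  rw [← Finset.sum_mul, ← mul_assoc]
  gcongr
  simpa only [cylinderProj, Matrix.diagonal_apply_eq] using
    norm_prod_czPhase_sub_one_sq_le M.gates b

namespace OneDQAC

/-- The inputs whose forward light cone is contained in `T`. -/
def inputsWithin (input : Fin n ↪ Fin N) (C : OneDQAC N d) (T : Finset (Fin N)) : Finset (Fin n) :=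
  Finset.univ.filter fun i => C.cone {input i} ⊆ T

theorem mem_inputsWithin {input : Fin n ↪ Fin N} {C : OneDQAC N d} {T : Finset (Fin N)}
    {i : Fin n} : i ∈ C.inputsWithin input T ↔ C.cone {input i} ⊆ T := by
  simp only [inputsWithin, Finset.mem_filter, Finset.mem_univ, true_and]

theorem cone_map_inputsWithin_subset (input : Fin n ↪ Fin N) (C : OneDQAC N d)
    (T : Finset (Fin N)) : C.cone ((C.inputsWithin input T).map input) ⊆ T := by
  intro q hq
  obtain ⟨r, hr, hqr⟩ := mem_cone_iff.mp hq
  obtain ⟨i, hi, rfl⟩ := Finset.mem_map.mp hr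
  exact mem_inputsWithin.mp hi hqr

theorem disjoint_inputsWithin (input : Fin n ↪ Fin N) (C : OneDQAC N d) {T T' : Finset (Fin N)}
    (h : Disjoint T T') : Disjoint (C.inputsWithin input T) (C.inputsWithin input T') :=
  Finset.disjoint_left.mpr fun i hi hi' =>
    have hself : input i ∈ C.cone {input i} := C.subset_cone _ (Finset.mem_singleton_self _)
    Finset.disjoint_left.mp h (mem_inputsWithin.mp hi hself) (mem_inputsWithin.mp hi' hself)

/-- The circuit without its heavy gates, those that contain the light cones of at least `k` inputs.
The light cones are those of the circuit whose earlier layers are already pruned. -/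
def prune (input : Fin n ↪ Fin N) (k : ℕ) : {d : ℕ} → OneDQAC N d → OneDQAC N d
  | _, .base L => .base L
  | _, .layer C M L => .layer (C.prune input k)
      (M.restrict fun T => ¬ k ≤ ((C.prune input k).inputsWithin input T).card) L

end OneDQAC

theorem CZLayer.card_gates_mul_le (M : CZLayer N) (input : Fin n ↪ Fin N) (C : OneDQAC N d)
    (hM : ∀ T ∈ M.gates, k ≤ (C.inputsWithin input T).card) : M.gates.card * k ≤ n :=
  calc M.gates.card * k ≤ ∑ T ∈ M.gates, (C.inputsWithin input T).card :=
        Finset.card_nsmul_le_sum _ _ _ hM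
    _ = (M.gates.biUnion (C.inputsWithin input)).card := (Finset.card_biUnion fun _ hT _ hT' hne =>
        C.disjoint_inputsWithin input (M.disjoint hT hT' hne)).symm
    _ ≤ n := (Finset.card_le_univ _).trans_eq (Fintype.card_fin n)

namespace OneDQACWithInput

theorem norm_heavy_sub_one_mul_le (I : OneDQACWithInput n N d) (hk : 0 < k) {e : ℕ}
    (C : OneDQAC N e) (M : CZLayer N) (hM : ∀ T ∈ M.gates, k ≤ (C.inputsWithin I.input T).card) :
    ‖(M.toMatrix - 1) * (C.toMatrix * I.initialMatrix)‖ ≤ 2 * √(n / k * (2 ^ n / 2 ^ k)) := by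
  have hgate (T) (hT : T ∈ M.gates) :
      ‖cylinderProj (R := ℂ) T (fun _ => true) * (C.toMatrix * I.initialMatrix)‖ ^ 2
        ≤ 2 ^ n / 2 ^ k := by
    have hn : (C.inputsWithin I.input T).card ≤ n :=
      (Finset.card_le_univ _).trans_eq (Fintype.card_fin n)
    refine (I.norm_cylinderProj_mul_initialMatrix_sq_le C
      (C.cone_map_inputsWithin_subset I.input T) _).trans ?_
    rw [pow_sub₀ _ two_ne_zero hn, div_eq_mul_inv]
    gcongr
    · exact one_le_two
    · exact hM T hT
  have hcard : (M.gates.card : ℝ) ≤ n / k := by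
    rw [le_div_iff₀ (by exact_mod_cast hk)]
    exact_mod_cast M.card_gates_mul_le I.input C hM
  refine le_of_sq_le_sq ?_ (by positivity)
  calc ‖(M.toMatrix - 1) * (C.toMatrix * I.initialMatrix)‖ ^ 2
      ≤ 4 * ∑ T ∈ M.gates, ‖cylinderProj (R := ℂ) T (fun _ => true)
          * (C.toMatrix * I.initialMatrix)‖ ^ 2 := M.norm_toMatrix_sub_one_mul_sq_le _
    _ ≤ 4 * (M.gates.card * (2 ^ n / 2 ^ k)) := by
        gcongr
        exact (Finset.sum_le_card_nsmul _ _ _ hgate).trans_eq (nsmul_eq_mul _ _)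
    _ ≤ 4 * (n / k * (2 ^ n / 2 ^ k)) := by gcongr
    _ = (2 * √(n / k * (2 ^ n / 2 ^ k))) ^ 2 := by
        rw [mul_pow, Real.sq_sqrt (by positivity)]
        norm_num

theorem norm_sub_prune_mul_le (I : OneDQACWithInput n N d) (hk : 0 < k) {e : ℕ} (C : OneDQAC N e) :
    ‖(C.toMatrix - (C.prune I.input k).toMatrix) * I.initialMatrix‖
      ≤ e * (2 * √(n / k * (2 ^ n / 2 ^ k))) := by
  induction C with
  | base L => simp only [OneDQAC.prune, sub_self, Matrix.zero_mul, norm_zero, Nat.cast_zero,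
      zero_mul, le_refl]
  | @layer e C M L ih =>
    set C' := C.prune I.input k
    set V := I.initialMatrix
    set heavy := M.restrict fun T => k ≤ (C'.inputsWithin I.input T).card
    set light := M.restrict fun T => ¬ k ≤ (C'.inputsWithin I.input T).card
    have hM : M.toMatrix = light.toMatrix * heavy.toMatrix :=
      congrArg Subtype.val (M.unitary_restrict_not_mul_restrict _).symm
    have hsplit : ((OneDQAC.layer C M L).toMatrix - (OneDQAC.layer C' light L).toMatrix) * V
        = L.toMatrix * M.toMatrix * ((C.toMatrix - C'.toMatrix) * V)
          + L.toMatrix * light.toMatrix * ((heavy.toMatrix - 1) * (C'.toMatrix * V)) := by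
      rw [OneDQAC.toMatrix, OneDQAC.toMatrix, hM]
      simp only [Matrix.sub_mul, Matrix.mul_sub, Matrix.mul_assoc, Matrix.one_mul]
      abel
    calc ‖((OneDQAC.layer C M L).toMatrix - (OneDQAC.layer C' light L).toMatrix) * V‖
        ≤ ‖(C.toMatrix - C'.toMatrix) * V‖
          + ‖(heavy.toMatrix - 1) * (C'.toMatrix * V)‖ := by
          rw [hsplit]
          exact (norm_add_le _ _).trans_eq (congrArg₂ _
            (frobenius_norm_unitary_mul (tensorUnitary L * M.unitary) _)
            (frobenius_norm_unitary_mul (tensorUnitary L * light.unitary) _))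
      _ ≤ e * (2 * √(n / k * (2 ^ n / 2 ^ k))) + 2 * √(n / k * (2 ^ n / 2 ^ k)) :=
          add_le_add ih (I.norm_heavy_sub_one_mul_le hk C' heavy fun T hT =>
            (Finset.mem_filter.mp hT).2)
      _ = (e + 1 : ℕ) * (2 * √(n / k * (2 ^ n / 2 ^ k))) := by push_cast; ring

end OneDQACWithInput

end Pruning

section Crossing

variable {n N d m : ℕ}

/-- The set `S` contains qubits on both sides of the cut between the positions `c - 1` and `c`. -/
def Crosses (S : Finset (Fin N)) (c : ℕ) : Prop :=
  (∃ q ∈ S, (q : ℕ) < c) ∧ ∃ q ∈ S, c ≤ (q : ℕ)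

namespace CZLayer

theorem forall_mem_spread {M : CZLayer N} {S : Finset (Fin N)} {p : Fin N → Prop}
    (hM : ∀ T ∈ M.gates, ∀ q ∈ T, ∀ r ∈ T, p q → p r) (hS : ∀ q ∈ S, p q) :
    ∀ q ∈ M.spread S, p q := by
  intro q hq
  rcases mem_spread.mp hq with hqS | ⟨T, hT, hqT, r, hrT, hrS⟩
  · exact hS q hqS
  · exact hM T hT r hrT q hqT (hS r hrS)

theorem crosses_of_crosses_spread {M : CZLayer N} {S : Finset (Fin N)} {c : ℕ}
    (hM : ∀ T ∈ M.gates, ¬ Crosses T c) (h : Crosses (M.spread S) c) : Crosses S c := by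
  obtain ⟨⟨q, hq, hqc⟩, r, hr, hcr⟩ := h
  by_contra hS
  by_cases hlt : ∀ s ∈ S, (s : ℕ) < c
  · refine hcr.not_gt (forall_mem_spread (p := fun s => (s : ℕ) < c) ?_ hlt r hr)
    exact fun T hT s hs t ht hsc => not_le.mp fun htc => hM T hT ⟨⟨s, hs, hsc⟩, t, ht, htc⟩
  · have hge : ∀ s ∈ S, c ≤ (s : ℕ) := by grind [Crosses]
    refine hqc.not_ge (forall_mem_spread (p := fun s => c ≤ (s : ℕ)) ?_ hge q hq)
    exact fun T hT s hs t ht hsc => not_lt.mp fun htc => hM T hT ⟨⟨t, ht, htc⟩, s, hs, hsc⟩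

theorem not_crosses_of_Icc_mem_gates {M : CZLayer N} {a b : Fin N} (h : Finset.Icc a b ∈ M.gates)
    (hab : a ≤ b) {T : Finset (Fin N)} (hT : T ∈ M.gates) :
    ¬ Crosses T a ∧ ¬ Crosses T (b + 1) := by
  obtain ⟨a', b', -, rfl⟩ := M.contiguous T hT
  have heq {q : Fin N} (hq : q ∈ Finset.Icc a b) (hq' : q ∈ Finset.Icc a' b') :
      Finset.Icc a' b' = Finset.Icc a b := M.disjoint.elim_finset hT h q hq' hq
  simp only [Crosses, Finset.mem_Icc, Fin.le_def] at heq hab ⊢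
  refine ⟨fun ⟨⟨q, hq, hqa⟩, r, hr, har⟩ => ?_, fun ⟨⟨q, hq, hqb⟩, r, hr, hbr⟩ => ?_⟩
  · have := heq (q := a) ⟨le_rfl, hab⟩ (by omega)
    have : q ∈ Finset.Icc a b := this ▸ Finset.mem_Icc.mpr hq
    exact hqa.not_ge (Finset.mem_Icc.mp this).1
  · have := heq (q := b) ⟨hab, le_rfl⟩ (by omega)
    have : r ∈ Finset.Icc a b := this ▸ Finset.mem_Icc.mpr hr
    exact hbr.not_gt (Nat.lt_succ_of_le (Finset.mem_Icc.mp this).2)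

theorem subset_or_crosses_of_crosses_spread {M : CZLayer N} {S : Finset (Fin N)} {a b : Fin N}
    {c : ℕ} (h : Finset.Icc a b ∈ M.gates) (hc : Crosses (Finset.Icc a b) c)
    (hS : Crosses (M.spread S) c) : S ⊆ Finset.Icc a b ∨ Crosses S a ∨ Crosses S (b + 1) := by
  obtain ⟨⟨u, hu, huc⟩, v, hv, hcv⟩ := hc
  obtain ⟨⟨q, hq, hqc⟩, r, hr, hcr⟩ := hS
  obtain ⟨hau, -⟩ := Finset.mem_Icc.mp hu
  obtain ⟨hav, hvb⟩ := Finset.mem_Icc.mp hv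
  rw [or_iff_not_imp_left, Finset.not_subset]
  rintro ⟨s, hsS, hs⟩
  have hs' : s ∈ M.spread S := Finset.mem_union_left _ hsS
  rw [Finset.mem_Icc, not_and_or] at hs
  rcases hs with hsa | hbs
  · exact .inl <| M.crosses_of_crosses_spread
      (fun T hT => (M.not_crosses_of_Icc_mem_gates h (hav.trans hvb) hT).1)
      ⟨⟨s, hs', by omega⟩, r, hr, by omega⟩
  · exact .inr <| M.crosses_of_crosses_spread
      (fun T hT => (M.not_crosses_of_Icc_mem_gates h (hav.trans hvb) hT).2)
      ⟨⟨q, hq, by omega⟩, s, hs', by omega⟩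

end CZLayer

namespace OneDQAC

open scoped Classical in
/-- The inputs whose forward light cone crosses the cut between the positions `c - 1` and `c`. -/
noncomputable def crossing (input : Fin n ↪ Fin N) (C : OneDQAC N d) (c : ℕ) : Finset (Fin n) :=
  Finset.univ.filter fun i => Crosses (C.cone {input i}) c

theorem mem_crossing {input : Fin n ↪ Fin N} {C : OneDQAC N d} {c : ℕ} {i : Fin n} :
    i ∈ C.crossing input c ↔ Crosses (C.cone {input i}) c := by
  simp only [crossing, Finset.mem_filter, Finset.mem_univ, true_and]

theorem card_crossing_layer_le {input : Fin n ↪ Fin N} {C : OneDQAC N d} {M : CZLayer N} {X : ℕ}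
    (L : SingleLayer N) (hM : ∀ T ∈ M.gates, (C.inputsWithin input T).card ≤ m)
    (hC : ∀ c, (C.crossing input c).card ≤ X) (c : ℕ) :
    ((C.layer M L).crossing input c).card ≤ m + 2 * X := by
  by_cases h : ∃ T ∈ M.gates, Crosses T c
  · obtain ⟨T, hT, hTc⟩ := h
    obtain ⟨a, b, -, rfl⟩ := M.contiguous T hT
    have hsub : (C.layer M L).crossing input c
        ⊆ C.inputsWithin input (Finset.Icc a b) ∪ (C.crossing input a ∪ C.crossing input (b + 1)) :=
      fun i hi => by
        simpa only [Finset.mem_union, mem_inputsWithin, mem_crossing] using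
          M.subset_or_crosses_of_crosses_spread hT hTc (mem_crossing.mp hi)
    calc ((C.layer M L).crossing input c).card
        ≤ (C.inputsWithin input (Finset.Icc a b)).card
          + ((C.crossing input a).card + (C.crossing input (b + 1)).card) :=
          (Finset.card_le_card hsub).trans <| (Finset.card_union_le _ _).trans <|
            Nat.add_le_add_left (Finset.card_union_le _ _) _
      _ ≤ m + (X + X) := add_le_add (hM _ hT) (add_le_add (hC _) (hC _))
      _ = m + 2 * X := by rw [two_mul]
  · have hsub : (C.layer M L).crossing input c ⊆ C.crossing input c := fun i hi =>
      mem_crossing.mpr <| M.crosses_of_crosses_spread (fun T hT hTc => h ⟨T, hT, hTc⟩)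
        (mem_crossing.mp hi)
    linarith [Finset.card_le_card hsub, hC c]

theorem card_crossing_prune_le (input : Fin n ↪ Fin N) (C : OneDQAC N d) (c : ℕ) :
    ((C.prune input (m + 1)).crossing input c).card ≤ m * (2 ^ d - 1) := by
  induction C generalizing c with
  | base L =>
    refine (Finset.card_eq_zero.mpr (Finset.eq_empty_of_forall_notMem fun i hi => ?_)).le.trans
      (Nat.zero_le _)
    obtain ⟨⟨q, hq, hqc⟩, r, hr, hcr⟩ := mem_crossing.mp hi
    rw [prune, cone, Finset.mem_singleton] at hq hr
    subst hq hr
    exact hcr.not_gt hqc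
  | @layer d C M L ih =>
    refine (card_crossing_layer_le (m := m) L (fun T hT => ?_) ih c).trans_eq ?_
    · exact Nat.le_of_lt_succ (not_le.mp (Finset.mem_filter.mp hT).2)
    · have := Nat.one_le_two_pow (n := d)
      zify [Nat.one_le_two_pow]
      ring

theorem exists_notMem_cone_prune (input : Fin n ↪ Fin N) (C : OneDQAC N d) (o : Fin N)
    (hn : 2 * m * (2 ^ d - 1) + 1 < n) : ∃ i, o ∉ (C.prune input (m + 1)).cone {input i} := by
  set C' := C.prune input (m + 1)
  by_contra! h
  have hcover : Finset.univ
      ⊆ C'.inputsWithin input {o} ∪ (C'.crossing input o ∪ C'.crossing input (o + 1)) := by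
    intro i _
    simp only [Finset.mem_union, mem_inputsWithin, mem_crossing]
    have := h i
    grind [Crosses]
  have hself {i} (hi : i ∈ C'.inputsWithin input {o}) : input i = o :=
    Finset.mem_singleton.mp <| mem_inputsWithin.mp hi <|
      C'.subset_cone _ (Finset.mem_singleton_self _)
  have hwithin : (C'.inputsWithin input {o}).card ≤ 1 := Finset.card_le_one.mpr fun i hi j hj =>
    input.injective ((hself hi).trans (hself hj).symm)
  have hcard : n ≤ (C'.inputsWithin input {o}).card
      + ((C'.crossing input o).card + (C'.crossing input (o + 1)).card) :=
    calc n = (Finset.univ : Finset (Fin n)).card := (Finset.card_fin n).symm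
      _ ≤ _ := (Finset.card_le_card hcover).trans <| (Finset.card_union_le _ _).trans <|
        Nat.add_le_add_left (Finset.card_union_le _ _) _
  linarith [C.card_crossing_prune_le (m := m) input o,
    C.card_crossing_prune_le (m := m) input (o + 1)]

end OneDQAC

end Crossing

section Parity

variable {n N d : ℕ}

/-- The Pauli `X` gate, which exchanges the two basis states of a qubit. -/
def pauliX : Matrix Bool Bool ℂ := Matrix.of fun a b => if b = !a then 1 else 0

theorem pauliX_mem_unitary : pauliX ∈ unitary (Matrix Bool Bool ℂ) := by
  have hstar : star pauliX = pauliX := by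
    ext a b
    cases a <;> cases b <;> simp [pauliX]
  have hmul : pauliX * pauliX = 1 := by
    ext a b
    cases a <;> cases b <;> simp [pauliX, Matrix.mul_apply]
  rw [Unitary.mem_iff, hstar, hmul, and_self]

theorem parityFn_eq_xor (x : Fin n → Bool) (i : Fin n) :
    parityFn n x
      = (x i ^^ decide (Odd ((Finset.univ.erase i).filter fun j => x j = true).card)) := by
  rw [parityFn, ← Finset.insert_erase (Finset.mem_univ i), Finset.filter_insert,
    Finset.erase_insert (Finset.notMem_erase _ _)]
  cases hi : x i
  · rw [if_neg Bool.false_ne_true, Bool.false_xor]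
  · rw [if_pos rfl, Finset.card_insert_of_notMem (by simp), Bool.true_xor, ← decide_not]
    exact decide_eq_decide.mpr Nat.odd_add_one

theorem parityFn_update_not (x : Fin n → Bool) (i : Fin n) :
    parityFn n (Function.update x i !x i) = !parityFn n x := by
  have hrest : (Finset.univ.erase i).filter (fun j => Function.update x i (!x i) j = true)
      = (Finset.univ.erase i).filter fun j => x j = true :=
    Finset.filter_congr fun j hj => by rw [Function.update_of_ne (Finset.ne_of_mem_erase hj)]
  rw [parityFn_eq_xor _ i, parityFn_eq_xor x i, Function.update_self, hrest, Bool.not_xor]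

namespace OneDQACWithInput

theorem initialState_update_not (I : OneDQACWithInput n N d) (x : Fin n → Bool) (i : Fin n) :
    I.initialState (Function.update x i !x i)
      = siteMatrix (I.input i) pauliX *ᵥ I.initialState x := by
  funext b
  set b' := Function.update b (I.input i) !b (I.input i)
  have hinput : (∀ j, b (I.input j) = Function.update x i (!x i) j)
      ↔ ∀ j, b' (I.input j) = x j := forall_congr' fun j => by
    rcases eq_or_ne j i with rfl | hj
    · have hb' : b' (I.input j) = !b (I.input j) := Function.update_self ..
      rw [Function.update_self, hb', Bool.not_eq_eq_eq_not]
    · have hb' : b' (I.input j) = b (I.input j) :=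
        Function.update_of_ne (I.input.injective.ne hj) ..
      rw [Function.update_of_ne hj, hb']
  have hancilla (q : {q // q ∉ Set.range I.input}) : b q = b' q :=
    (Function.update_of_ne (fun h => q.2 ⟨i, h.symm⟩) _ _).symm
  calc I.initialState (Function.update x i !x i) b = I.initialState x b' := by
        simp only [initialState, hinput, hancilla]
    _ = ∑ v, pauliX (b (I.input i)) v * I.initialState x (Function.update b (I.input i) v) := by
        simp only [pauliX, Matrix.of_apply, ite_mul, one_mul, zero_mul, Finset.sum_ite_eq',
          Finset.mem_univ, if_true, b']
    _ = (siteMatrix (I.input i) pauliX *ᵥ I.initialState x) b := (siteMatrix_mulVec _ _ _ b).symm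

theorem outcomeProb_eq_norm_sq (I : OneDQACWithInput n N d) (x : Fin n → Bool) (v : Bool) :
    I.outcomeProb x v
      = ‖WithLp.toLp 2 (cylinderProj {I.output} (fun _ => v) *ᵥ I.finalState x)‖ ^ 2 := by
  rw [EuclideanSpace.norm_sq_eq]
  refine Finset.sum_congr rfl fun b _ => ?_
  rw [PiLp.toLp_apply, cylinderProj_mulVec]
  simp only [Finset.mem_singleton, forall_eq, apply_ite norm, norm_zero, ite_pow, ne_eq,
    OfNat.ofNat_ne_zero, not_false_eq_true, zero_pow]

theorem outcomeProb_add_outcomeProb_not (I : OneDQACWithInput n N d) (x : Fin n → Bool)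
    (v : Bool) : I.outcomeProb x v + I.outcomeProb x (!v) = 1 := by
  calc I.outcomeProb x v + I.outcomeProb x (!v) = ∑ b, ‖I.finalState x b‖ ^ 2 := by
        rw [outcomeProb, outcomeProb, ← Finset.sum_add_distrib]
        refine Finset.sum_congr rfl fun b _ => ?_
        cases b I.output <;> cases v <;> simp
    _ = ‖WithLp.toLp 2 (I.finalState x)‖ ^ 2 := by rw [EuclideanSpace.norm_sq_eq]
    _ = 1 := by
        rw [finalState, ← I.circuit.coe_unitary, norm_toLp_unitary_mulVec,
          I.norm_toLp_initialState, one_pow]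

/- Flipping the `i`-th input applies to the final state the image of a Pauli `X` under conjugation
by the circuit. -/
theorem outcomeProb_update_not (I : OneDQACWithInput n N d) {i : Fin n}
    (hi : I.output ∉ I.circuit.cone {I.input i}) (x : Fin n → Bool) (v : Bool) :
    I.outcomeProb (Function.update x i !x i) v = I.outcomeProb x v := by
  set U := I.circuit.unitary
  set X : Matrix.unitaryGroup (QBits N) ℂ :=
    ⟨siteMatrix (I.input i) pauliX, siteMatrix_mem_unitary _ pauliX_mem_unitary⟩
  have hfinal : I.finalState (Function.update x i !x i)
      = ((U * X * star U : Matrix.unitaryGroup (QBits N) ℂ) : Matrix _ _ ℂ) *ᵥ I.finalState x := by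
    rw [finalState, finalState, initialState_update_not, ← I.circuit.coe_unitary,
      Matrix.mulVec_mulVec, Matrix.mulVec_mulVec]
    congr 1
    exact congrArg Subtype.val (inv_mul_cancel_right (U * X) U).symm
  have hcomm : Commute (cylinderProj {I.output} fun _ => v)
      ((U * X * star U : Matrix.unitaryGroup (QBits N) ℂ) : Matrix _ _ ℂ) :=
    ((actsOn_siteMatrix _ pauliX).conj_circuit I.circuit).commute_cylinderProj
      (Finset.disjoint_singleton_right.mpr hi) _
  rw [outcomeProb_eq_norm_sq, outcomeProb_eq_norm_sq, hfinal, Matrix.mulVec_mulVec, hcomm.eq,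
    ← Matrix.mulVec_mulVec, norm_toLp_unitary_mulVec]

theorem successProb_parityFn_eq_half (I : OneDQACWithInput n N d) {i : Fin n}
    (hi : I.output ∉ I.circuit.cone {I.input i}) : I.successProb (parityFn n) = 1 / 2 := by
  have hflip : Function.Involutive fun x : Fin n → Bool => Function.update x i !x i := fun x => by
    simp only [Function.update_self, Bool.not_not, Function.update_idem, Function.update_eq_self]
  have hswap : ∑ x, I.outcomeProb x (parityFn n x) = ∑ x, I.outcomeProb x (!parityFn n x) := by
    rw [← Equiv.sum_comp hflip.toPerm]
    refine Finset.sum_congr rfl fun x _ => ?_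
    rw [← parityFn_update_not x i]
    exact I.outcomeProb_update_not hi x _
  have htotal :
      ∑ x, I.outcomeProb x (parityFn n x) + ∑ x, I.outcomeProb x (!parityFn n x) = 2 ^ n := by
    simp only [← Finset.sum_add_distrib, outcomeProb_add_outcomeProb_not, Finset.sum_const,
      Finset.card_univ, Fintype.card_pi_const, Fintype.card_bool, nsmul_eq_mul, mul_one,
      Nat.cast_pow, Nat.cast_ofNat]
  rw [successProb, div_eq_div_iff (by positivity) two_ne_zero]
  linarith

section

open scoped Matrix.Norms.Frobenius

/-- The matrix `Y`, whose columns are indexed by the inputs, with every column `x` restricted to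
the basis states in which the output qubit has the value `f x`. -/
def correctPart (I : OneDQACWithInput n N d) (f : (Fin n → Bool) → Bool)
    (Y : Matrix (QBits N) (Fin n → Bool) ℂ) : Matrix (QBits N) (Fin n → Bool) ℂ :=
  Matrix.of fun b x => if b I.output = f x then Y b x else 0

theorem correctPart_sub (I : OneDQACWithInput n N d) (f : (Fin n → Bool) → Bool)
    (Y Y' : Matrix (QBits N) (Fin n → Bool) ℂ) :
    I.correctPart f (Y - Y') = I.correctPart f Y - I.correctPart f Y' := by
  ext b x
  simp only [correctPart, Matrix.sub_apply, Matrix.of_apply]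
  rw [ite_sub_ite, sub_zero]

theorem norm_correctPart_sq (I : OneDQACWithInput n N d) (f : (Fin n → Bool) → Bool)
    (Y : Matrix (QBits N) (Fin n → Bool) ℂ) :
    ‖I.correctPart f Y‖ ^ 2 = ∑ x, ∑ b, if b I.output = f x then ‖Y b x‖ ^ 2 else 0 := by
  simp only [frobenius_norm_sq_eq_sum_col, EuclideanSpace.norm_sq_eq, Matrix.col_apply,
    correctPart, Matrix.of_apply, apply_ite norm, norm_zero, ite_pow, ne_eq,
    OfNat.ofNat_ne_zero, not_false_eq_true, zero_pow]

theorem norm_correctPart_le (I : OneDQACWithInput n N d) (f : (Fin n → Bool) → Bool)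
    (Y : Matrix (QBits N) (Fin n → Bool) ℂ) : ‖I.correctPart f Y‖ ≤ ‖Y‖ := by
  refine le_of_sq_le_sq ?_ (norm_nonneg _)
  rw [norm_correctPart_sq, frobenius_norm_sq_eq_sum_col]
  simp only [EuclideanSpace.norm_sq_eq]
  gcongr with x _ b _
  split_ifs
  · exact le_rfl
  · positivity

theorem successProb_eq_norm_correctPart_sq (I : OneDQACWithInput n N d)
    (f : (Fin n → Bool) → Bool) :
    I.successProb f = ‖I.correctPart f (I.circuit.toMatrix * I.initialMatrix)‖ ^ 2 / 2 ^ n := by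
  rw [norm_correctPart_sq]
  rfl

theorem norm_toMatrix_mul_initialMatrix_sq (I : OneDQACWithInput n N d) {e : ℕ}
    (C : OneDQAC N e) : ‖C.toMatrix * I.initialMatrix‖ ^ 2 = 2 ^ n := by
  rw [← C.coe_unitary, frobenius_norm_unitary_mul, norm_initialMatrix_sq]

theorem successProb_le_one (I : OneDQACWithInput n N d) (f : (Fin n → Bool) → Bool) :
    I.successProb f ≤ 1 := by
  rw [successProb_eq_norm_correctPart_sq, div_le_one (by positivity),
    ← I.norm_toMatrix_mul_initialMatrix_sq I.circuit]
  gcongr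
  exact I.norm_correctPart_le f _

theorem successProb_le_add (I : OneDQACWithInput n N d) (f : (Fin n → Bool) → Bool) {e : ℕ}
    (C : OneDQAC N e) :
    I.successProb f ≤ ({I with circuit := C} : OneDQACWithInput n N e).successProb f
      + 2 * (‖(I.circuit.toMatrix - C.toMatrix) * I.initialMatrix‖ / √(2 ^ n)) := by
  set Y := I.circuit.toMatrix * I.initialMatrix
  set Y' := C.toMatrix * I.initialMatrix
  set s : ℝ := √(2 ^ n)
  have hs : s ^ 2 = 2 ^ n := Real.sq_sqrt (by positivity)
  have hY : ‖I.correctPart f Y‖ ≤ s := (I.norm_correctPart_le f Y).trans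
    (Real.le_sqrt_of_sq_le (I.norm_toMatrix_mul_initialMatrix_sq _).le)
  have hY' : ‖I.correctPart f Y'‖ ≤ s := (I.norm_correctPart_le f Y').trans
    (Real.le_sqrt_of_sq_le (I.norm_toMatrix_mul_initialMatrix_sq _).le)
  have hdiff : ‖I.correctPart f Y‖ - ‖I.correctPart f Y'‖ ≤ ‖Y - Y'‖ :=
    (norm_sub_norm_le _ _).trans <| by
      rw [← correctPart_sub]
      exact I.norm_correctPart_le f _
  have hsq : ‖I.correctPart f Y‖ ^ 2 ≤ ‖I.correctPart f Y'‖ ^ 2 + 2 * (‖Y - Y'‖ * s) := by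
    nlinarith [norm_nonneg (I.correctPart f Y), norm_nonneg (I.correctPart f Y'),
      norm_nonneg (Y - Y')]
  have hsub : (I.circuit.toMatrix - C.toMatrix) * I.initialMatrix = Y - Y' := Matrix.sub_mul _ _ _
  have hsuccess : ({I with circuit := C} : OneDQACWithInput n N e).successProb f
      = ‖I.correctPart f Y'‖ ^ 2 / 2 ^ n := successProb_eq_norm_correctPart_sq _ f
  rw [successProb_eq_norm_correctPart_sq, hsuccess, hsub, ← hs,
    div_le_iff₀ (by positivity), add_mul, div_mul_cancel₀ _ (by positivity)]
  refine hsq.trans_eq ?_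
  field_simp

theorem successProb_parityFn_le (I : OneDQACWithInput n N d) {m : ℕ}
    (hn : 2 * m * (2 ^ d - 1) + 1 < n) :
    I.successProb (parityFn n)
      ≤ 1 / 2 + 4 * d * √(n / (m + 1 : ℕ) / 2 ^ (m + 1)) := by
  obtain ⟨i, hi⟩ := I.circuit.exists_notMem_cone_prune I.input I.output hn
  set C := I.circuit.prune I.input (m + 1)
  set t : ℝ := n / (m + 1 : ℕ) / 2 ^ (m + 1)
  have herror : ‖(I.circuit.toMatrix - C.toMatrix) * I.initialMatrix‖ / √(2 ^ n)
      ≤ d * (2 * √t) := by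
    rw [div_le_iff₀ (by positivity), mul_assoc, mul_assoc, ← Real.sqrt_mul (by positivity),
      div_mul_eq_mul_div, mul_div_assoc]
    exact I.norm_sub_prune_mul_le (Nat.succ_pos m) I.circuit
  calc I.successProb (parityFn n) ≤ 1 / 2
        + 2 * (‖(I.circuit.toMatrix - C.toMatrix) * I.initialMatrix‖ / √(2 ^ n)) :=
        (I.successProb_le_add (parityFn n) C).trans_eq <| congrArg (· + _) <|
          successProb_parityFn_eq_half ({I with circuit := C} : OneDQACWithInput n N d) hi
    _ ≤ 1 / 2 + 2 * (d * (2 * √t)) := by gcongr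
    _ = 1 / 2 + 4 * d * √t := by ring

end

end OneDQACWithInput

end Parity

section Bounds

open Filter Real

lemma two_mul_two_pow_sub_one_mul_le_pow {d : ℕ} (hd : 1 ≤ d) {t : ℝ} (ht : 18 ≤ t) :
    2 * (2 ^ d - 1) * (d + 2 + t / 3) ≤ t ^ d := by
  induction d, hd using Nat.le_induction with
  | base => norm_num; linarith
  | succ d hd ih =>
    have htwo : (2 : ℝ) ≤ 2 ^ d := le_self_pow₀ one_le_two (by lia)
    have hpow : (2 : ℝ) ^ (d + 1) - 1 ≤ 3 * (2 ^ d - 1) := by rw [pow_succ]; linarith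
    have hlin : ((d + 1 : ℕ) : ℝ) + 2 + t / 3 ≤ 2 * (d + 2 + t / 3) := by
      push_cast
      linarith [(Nat.cast_nonneg d : (0 : ℝ) ≤ d)]
    calc 2 * ((2 : ℝ) ^ (d + 1) - 1) * ((d + 1 : ℕ) + 2 + t / 3)
        ≤ 2 * (3 * (2 ^ d - 1)) * (2 * (d + 2 + t / 3)) := by gcongr; linarith
      _ = 6 * (2 * (2 ^ d - 1) * (d + 2 + t / 3)) := by ring
      _ ≤ 6 * t ^ d := by gcongr
      _ ≤ t * t ^ d := by gcongr; linarith
      _ = t ^ (d + 1) := (pow_succ' t d).symm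

lemma div_two_pow_le {d k : ℕ} {t x : ℝ} (hk : d + 1 + t / 3 ≤ k) (hx : x ≤ 2 * 2 ^ (d + 1)) :
    x / 2 ^ k ≤ 2 * 2 ^ (-(t / 3)) := by
  rw [div_le_iff₀ (by positivity)]
  calc x ≤ 2 * 2 ^ ((d + 1 : ℕ) : ℝ) := by rwa [rpow_natCast]
    _ ≤ 2 * 2 ^ (-(t / 3) + k) := by
        gcongr
        · exact one_le_two
        · push_cast
          linarith
    _ = 2 * 2 ^ (-(t / 3)) * 2 ^ k := by rw [rpow_add two_pos, rpow_natCast, mul_assoc]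

lemma exists_pruning_level {n d : ℕ} (hd : 1 ≤ d) {t : ℝ} (ht : 18 ≤ t) (hn : t ^ d = n) :
    ∃ m : ℕ, 2 * m * (2 ^ d - 1) + 1 < n ∧
      (n / (m + 1 : ℕ) / 2 ^ (m + 1) : ℝ) ≤ 2 * 2 ^ (-(t / 3)) := by
  set D : ℕ := 2 * (2 ^ d - 1) with hD
  have htwo : 2 ≤ 2 ^ d := le_self_pow₀ one_le_two (by lia)
  have hDcast : (D : ℝ) = 2 * (2 ^ d - 1) := by
    rw [hD]
    push_cast [Nat.one_le_two_pow]
    rfl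
  have hDpos : (0 : ℝ) < D := by exact_mod_cast (by lia : 0 < D)
  have hlevel : d + 2 + t / 3 ≤ (n : ℝ) / D := by
    rw [le_div_iff₀' hDpos, hDcast, ← hn]
    exact two_mul_two_pow_sub_one_mul_le_pow hd ht
  have hDn : D ≤ n := by
    have : (1 : ℝ) ≤ n / D := by linarith [(Nat.cast_nonneg d : (0 : ℝ) ≤ d)]
    exact_mod_cast (one_le_div hDpos).mp this
  obtain ⟨m, hm⟩ : ∃ m, n / D = m + 1 :=
    Nat.exists_eq_succ_of_ne_zero (Nat.div_pos hDn (by lia)).ne'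
  have hle : (m + 1) * D ≤ n := hm ▸ Nat.div_mul_le_self n D
  have hlt : (n : ℝ) / D < m + 2 := by
    have hfloor := Nat.lt_floor_add_one ((n : ℝ) / D)
    rw [Nat.floor_div_eq_div, hm] at hfloor
    push_cast at hfloor
    linarith
  refine ⟨m, ?_, div_two_pow_le (d := d) (by push_cast; linarith) ?_⟩
  · have hsplit : (m + 1) * D = 2 * m * (2 ^ d - 1) + D := by rw [hD]; ring
    lia
  · rw [div_lt_iff₀ hDpos, hDcast] at hlt
    rw [div_le_iff₀ (by positivity), pow_succ]
    push_cast
    nlinarith [pow_pos (two_pos : (0 : ℝ) < 2) d, (Nat.cast_nonneg m : (0 : ℝ) ≤ m)]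

lemma half_le_sqrt_two_mul_rpow {t : ℝ} (ht : t ≤ 21) :
    1 / 2 ≤ 4 * (√2 * (2 : ℝ) ^ (-(t / 6))) := by
  have hvalue : (2 : ℝ) ^ (-3 : ℝ) = 1 / 8 := by
    rw [rpow_neg two_pos.le]
    norm_num
  have hmono : (2 : ℝ) ^ (-3 : ℝ) ≤ √2 * 2 ^ (-(t / 6)) := by
    rw [sqrt_eq_rpow, ← rpow_add two_pos]
    exact rpow_le_rpow_of_exponent_le one_le_two (by linarith)
  linarith

namespace OneDQACWithInput

theorem successProb_parityFn_le_rpow {n N d : ℕ} (I : OneDQACWithInput n N d) (hd : 1 ≤ d) :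
    I.successProb (parityFn n)
      ≤ 1 / 2 + 4 * √2 * d * (2 : ℝ) ^ (-((n : ℝ) ^ (1 / (d : ℝ)) / 6)) := by
  set t : ℝ := (n : ℝ) ^ (1 / (d : ℝ)) with ht
  obtain hsmall | hlarge := le_total t 21
  · have hhalf := half_le_sqrt_two_mul_rpow hsmall
    calc I.successProb (parityFn n) ≤ 1 / 2 + 1 / 2 := by
          linarith [I.successProb_le_one (parityFn n)]
      _ ≤ 1 / 2 + d * (4 * (√2 * (2 : ℝ) ^ (-(t / 6)))) := by
          gcongr
          exact hhalf.trans (le_mul_of_one_le_left (by positivity) (by exact_mod_cast hd))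
      _ = 1 / 2 + 4 * √2 * d * 2 ^ (-(t / 6)) := by ring
  · have htn : t ^ d = n := by
      rw [ht, one_div, rpow_inv_natCast_pow n.cast_nonneg (by lia)]
    obtain ⟨m, hm, herror⟩ := exists_pruning_level hd (by linarith) htn
    have hsqrt : √(2 * (2 : ℝ) ^ (-(t / 3))) = √2 * 2 ^ (-(t / 6)) := by
      rw [sqrt_mul zero_le_two, sqrt_eq_rpow (2 ^ _), ← rpow_mul zero_le_two]
      ring_nf
    calc I.successProb (parityFn n)
        ≤ 1 / 2 + 4 * d * √(n / (m + 1 : ℕ) / 2 ^ (m + 1)) := I.successProb_parityFn_le hm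
      _ ≤ 1 / 2 + 4 * d * √(2 * (2 : ℝ) ^ (-(t / 3))) := by gcongr
      _ = 1 / 2 + 4 * √2 * d * 2 ^ (-(t / 6)) := by rw [hsqrt]; ring

theorem successProb_parityFn_le_half {n N : ℕ} (I : OneDQACWithInput n N 0) (hn : 2 ≤ n) :
    I.successProb (parityFn n) ≤ 1 / 2 := by
  simpa using I.successProb_parityFn_le (m := 0) (by lia)

end OneDQACWithInput

lemma eventually_mul_rpow_neg_sq_lt :
    ∀ᶠ ℓ : ℝ in atTop, 4 * √2 * ℓ * (2 : ℝ) ^ (-(ℓ ^ 2 / 6)) < 1 / 6 := by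
  have hlim := (tendsto_pow_mul_exp_neg_atTop_nhds_zero 1).const_mul (4 * √2)
  rw [mul_zero] at hlim
  filter_upwards [hlim.eventually_lt_const (show (0 : ℝ) < 1 / 6 by norm_num),
    eventually_ge_atTop (6 / log 2)] with ℓ hlt hℓ
  refine lt_of_le_of_lt ?_ hlt
  have hℓ0 : 0 ≤ ℓ := (by positivity : 0 ≤ 6 / log 2).trans hℓ
  rw [pow_one, mul_assoc]
  gcongr
  rw [rpow_def_of_pos two_pos, exp_le_exp]
  rw [div_le_iff₀ (log_pos one_lt_two)] at hℓ
  nlinarith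

lemma sq_log_le_rpow_one_div {x d : ℝ} (hd : 0 < d) (hx0 : 0 < x) (hx : 1 < log x)
    (h : d ≤ 1 / 2 * (log x / log (log x))) : log x ^ 2 ≤ x ^ (1 / d) := by
  rw [← log_le_log_iff (by positivity) (by positivity), log_pow, log_rpow hx0, one_div,
    inv_mul_eq_div, le_div_iff₀ hd]
  rw [← mul_div_assoc, le_div_iff₀ (log_pos hx)] at h
  push_cast
  linarith

theorem eventually_half_mul_log_div_log_log_le_depth :
    ∀ᶠ n : ℕ in atTop, ∀ (d N : ℕ) (I : OneDQACWithInput n N d),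
      2 / 3 ≤ I.successProb (parityFn n) → 1 / 2 * (log n / log (log n)) ≤ d := by
  have hlog : Tendsto (fun n : ℕ => log (n : ℝ)) atTop atTop :=
    tendsto_log_atTop.comp tendsto_natCast_atTop_atTop
  filter_upwards [hlog.eventually eventually_mul_rpow_neg_sq_lt,
    hlog.eventually_ge_atTop (exp 1), eventually_ge_atTop 2] with n herror hexp hn d N I hI
  by_contra! hlt
  have hlog1 : 1 < log (n : ℝ) := lt_of_lt_of_le (by simp) hexp
  have hloglog : 1 ≤ log (log n) := (le_log_iff_exp_le (by linarith)).mpr hexp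
  obtain rfl | hd := d.eq_zero_or_pos
  · linarith [I.successProb_parityFn_le_half hn]
  have hroot : log (n : ℝ) ^ 2 ≤ (n : ℝ) ^ (1 / (d : ℝ)) :=
    sq_log_le_rpow_one_div (by exact_mod_cast hd) (by positivity) hlog1 hlt.le
  have hdepth : (d : ℝ) ≤ log n := by
    linarith [div_le_self (zero_le_one.trans hlog1.le) hloglog]
  have hbound : 4 * √2 * (d : ℝ) * (2 : ℝ) ^ (-((n : ℝ) ^ (1 / (d : ℝ)) / 6))
      ≤ 4 * √2 * log n * 2 ^ (-(log (n : ℝ) ^ 2 / 6)) := by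
    gcongr
    exact one_le_two
  linarith [I.successProb_parityFn_le_rpow hd]

end Bounds

theorem mainTheorem2 :
    (∀ n d N : ℕ, 1 ≤ n → 1 ≤ d → ∀ C : OneDQACWithInput n N d,
      C.successProb (parityFn n) ≤
        1 / 2 + 4 * Real.sqrt 2 * (d : ℝ) *
          (2 : ℝ) ^ (-((n : ℝ) ^ (1 / (d : ℝ)) / 6))) ∧
    (∃ c : ℝ, 0 < c ∧ ∃ n₀ : ℕ, ∀ n : ℕ, n₀ ≤ n → ∀ (d N : ℕ) (C : OneDQACWithInput n N d),
      2 / 3 ≤ C.successProb (parityFn n) →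
        c * (Real.log (n : ℝ) / Real.log (Real.log (n : ℝ))) ≤ (d : ℝ)) :=
  ⟨fun _ _ _ _ hd C => C.successProb_parityFn_le_rpow hd, 1 / 2, one_half_pos,
    Filter.eventually_atTop.mp eventually_half_mul_log_div_log_log_le_depth⟩
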